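/- Consider logistic regression in the plane: given $Z\in\mathbb{R}^{n\times 2}$ with rows $Z_1,\dots,Z_n$ and labels $Y\in\{-1,1\}^n$, let $$\mathrm{OPT}(Z,Y)=\inf_{\beta\in\mathbb{R}^2}\sum_{i=1}^n\ln\bigl(1+\exp(-Y_iZ_i\beta)\bigr),\qquad \mathrm{OPT}^{\mathrm{aff}}(Z,Y)=\inf_{\beta\in\mathbb{R}^2,\,b\in\mathbb{R}}\sum_{i=1}^n\ln\bigl(1+\exp(-Y_i(Z_i\beta+b))\bigr)$$ be the optimal costs without and with an intercept. A randomized one-pass streaming algorithm with $s$ bits of space reads the labelled points $(Z_i,Y_i)$ one after the other, keeps only $s$ bits of memory between consecutive points (random coins, a clock and computation time are not charged), and reports a real number $v$ at the end. It approximates a value $\mathrm{OPT}\ge 0$ up to the factor $\alpha\ge 1$ with failure probability $\delta$ on a class of inputs if, on each input of the class, $\mathrm{OPT}/\alpha\le v\le\alpha\,\mathrm{OPT}$ except with probability at most $\delta$. For every $\delta\in[0,1/2)$ there are $c>0$ and $n_0$ such that for all $n\ge n_0$, all finite factors $\alpha\ge1$ and all $s$ the following hold for every such algorithm with $s$ bits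 of space. 1. If it approximates $\mathrm{OPT}$ up to the factor $\alpha$ with failure probability $\delta$ on all inputs of $n$ points (or merely on those whose coordinates are integers of absolute value at most $2^n$), then $s\ge c\,n/\log n$. 2. If it approximates $\mathrm{OPT}^{\mathrm{aff}}$ up to the factor $\alpha$ with failure probability $\delta$ on all inputs of $n$ points whose coordinates are integers of absolute value at most $n^2$ (so $O(\log n)$ bits per point), then $s\ge c\,n$; in terms of the total input size $N=\Theta(n\log n)$ in bits this is $s=\Omega(N/\log N)$. -/

import Mathlib

namespace LogisticStreaming

noncomputable section

/-- A data set of `n` labelled points in `ℝ^d`: the data matrix `Z ∈ ℝ^{n × d}` and the labels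
`Y ∈ {-1, 1}^n` (`ℤˣ` is the two-element type `{1, -1}`). -/
structure Instance (n d : ℕ) where
  Z : Matrix (Fin n) (Fin d) ℝ
  Y : Fin n → ℤˣ

namespace Instance

variable {n d : ℕ}

/-- The negative log-likelihood `∑ i, ln (1 + exp (-Yᵢ Zᵢ β))`. -/
def cost (I : Instance n d) (β : Fin d → ℝ) : ℝ :=
  ∑ i, Real.log (1 + Real.exp (-(((I.Y i : ℤ) : ℝ) * (I.Z i ⬝ᵥ β))))

/-- The optimal cost; an infimum, since it is not attained on separable data, where it is `0`. -/
def opt (I : Instance n d) : ℝ := ⨅ β : Fin d → ℝ, I.cost β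

/-- The negative log-likelihood of the model with intercept `b`. -/
def affineCost (I : Instance n d) (β : Fin d → ℝ) (b : ℝ) : ℝ :=
  ∑ i, Real.log (1 + Real.exp (-(((I.Y i : ℤ) : ℝ) * (I.Z i ⬝ᵥ β + b))))

/-- The optimal cost of the model with intercept. -/
def affineOpt (I : Instance n d) : ℝ := ⨅ p : (Fin d → ℝ) × ℝ, I.affineCost p.1 p.2

/-- The stream presenting the labelled points one after the other. -/
def stream (I : Instance n d) : List ((Fin d → ℝ) × ℤˣ) :=
  List.ofFn fun i => (I.Z i, I.Y i)

/-- All coordinates are integers of absolute value at most `M`. -/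
def OnGrid (I : Instance n d) (M : ℕ) : Prop :=
  ∀ i j, ∃ z : ℤ, I.Z i j = (z : ℝ) ∧ |z| ≤ (M : ℤ)

end Instance

/-- A randomized one-pass streaming algorithm with `s` bits of working memory that reads labelled
points of `ℝ^d` and reports a real number. `Ω` is the space of random coins. Coins, a clock and
computation time are free, and only the content of the memory is carried from one item to the
next; as the update sees the clock, this includes algorithms that toss fresh coins at each step.
-/
structure StreamingAlgorithm (Ω : Type*) (d s : ℕ) where
  init : Ω → (Fin s → Bool)
  update : Ω → ℕ → (Fin s → Bool) → (Fin d → ℝ) × ℤˣ → (Fin s → Bool)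
  output : Ω → (Fin s → Bool) → ℝ

namespace StreamingAlgorithm

variable {Ω : Type*} {d s : ℕ}

/-- The memory after reading a list of items, from memory content `m` at time `t`. -/
def runFrom (A : StreamingAlgorithm Ω d s) (ω : Ω) :
    ℕ → (Fin s → Bool) → List ((Fin d → ℝ) × ℤˣ) → (Fin s → Bool)
  | _, m, [] => m
  | t, m, p :: ps => A.runFrom ω (t + 1) (A.update ω t m p) ps

/-- The number reported after one pass over the data set. -/
def result (A : StreamingAlgorithm Ω d s) (ω : Ω) {n : ℕ} (I : Instance n d) : ℝ :=
  A.output ω (A.runFrom ω 0 (A.init ω) I.stream)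

end StreamingAlgorithm

/-- `v` approximates `x ≥ 0` up to the multiplicative factor `α ≥ 1`. -/
def ApproxWithin (α v x : ℝ) : Prop := x / α ≤ v ∧ v ≤ α * x

/-- On each data set of `n` points in the class `P`, the algorithm reports an `α`-approximation
of the target value, except with probability at most `δ` over its coins. -/
def Approximates {Ω : Type*} [MeasurableSpace Ω] (μ : MeasureTheory.Measure Ω) {d s : ℕ}
    (A : StreamingAlgorithm Ω d s) (n : ℕ) (P : Instance n d → Prop)
    (target : Instance n d → ℝ) (α δ : ℝ) : Prop :=
  ∀ I : Instance n d, P I →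
    μ {ω | ¬ ApproxWithin α (A.result ω I) (target I)} ≤ ENNReal.ofReal δ

end

end LogisticStreaming

/-! An approximation within any finite factor must tell optimal cost `0` from positive cost, that
is, separable from non-separable data. This decision solves augmented indexing, the memory after the
first part of the stream being the message (`Approximates.space_lower_bound`). Without intercept,
one point encodes all the bits as an integer, and a second point tests that integer against a
threshold, so a linear bound holds, stronger than the claimed `n / log n`. With intercept, the bits
select points on a parabola; a query point of the opposite label can be separated from them iff it
is not one of them, by strict convexity. For augmented indexing, a fixed message makes inputs and
error patterns correspond bijectively, so few inputs have few errors; `2 ^ s` messages cannot serve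
all inputs unless `s` is linear. The count is done with exponential moments. -/

namespace LogisticStreaming

open MeasureTheory

/-! ### Augmented indexing -/

/-- Decoding from the top coordinate down: the coordinates above `i` and the error pattern
determine the coordinate `i`. -/
theorem errorPattern_injective {m : ℕ} (dec : Fin m → (Fin m → Bool) → Bool)
    (hdec : ∀ i x y, (∀ j, i < j → x j = y j) → dec i x = dec i y) :
    Function.Injective fun (x : Fin m → Bool) i => xor (dec i x) (x i) := by
  intro x y h
  by_contra hne
  have hS : (Finset.univ.filter fun i => x i ≠ y i).Nonempty := by
    obtain ⟨i, hi⟩ := Function.ne_iff.1 hne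
    exact ⟨i, by simpa using hi⟩
  obtain ⟨i, hi, hmax⟩ := Finset.exists_max_image _ id hS
  have hagree : ∀ j, i < j → x j = y j := by
    intro j hj
    by_contra hxy
    exact absurd (hmax j (by simpa using hxy)) (not_le.2 hj)
  have hi' : xor (dec i x) (x i) = xor (dec i y) (y i) := congrFun h i
  rw [hdec i x y hagree, Bool.xor_right_inj] at hi'
  exact (Finset.mem_filter.1 hi).2 hi'

theorem sum_prod_weight (m : ℕ) (r : ℝ) :
    ∑ E : Fin m → Bool, ∏ i, (if E i then r else 1) = (r + 1) ^ m := by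
  have h := Finset.prod_univ_sum (fun _ : Fin m => (Finset.univ : Finset Bool))
    (fun _ b => if b then r else (1 : ℝ))
  rw [Fintype.piFinset_univ] at h
  simpa using h.symm

/-- The deterministic, average-case form of the augmented indexing lower bound. -/
theorem augmentedIndex_deterministic {m s : ℕ} {δ : ℝ} (hδ : δ < 1 / 2)
    (msg : (Fin m → Bool) → (Fin s → Bool))
    (dec : (Fin s → Bool) → Fin m → (Fin m → Bool) → Bool)
    (hdec : ∀ M i x y, (∀ j, i < j → x j = y j) → dec M i x = dec M i y)
    (herr : ∑ x, ∑ i, (if dec (msg x) i x ≠ x i then (1 : ℝ) else 0) ≤ 2 ^ m * (m * δ)) :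
    2 * (1 / 2 - δ) ^ 2 * m ≤ s := by
  -- This `t` maximizes the final exponent `t * (1 / 2 - δ) - t ^ 2 / 8`.
  set t : ℝ := 4 * (1 / 2 - δ) with ht
  have ht0 : 0 < t := by linarith
  set err : (Fin m → Bool) → ℝ := fun x => ∑ i, (if dec (msg x) i x ≠ x i then (1 : ℝ) else 0)
    with herr_def
  have hupper : ∑ x, Real.exp (-t * err x) ≤ 2 ^ s * (Real.exp (-t) + 1) ^ m := by
    calc ∑ x, Real.exp (-t * err x)
        = ∑ x, ∏ i, (if xor (dec (msg x) i x) (x i) then Real.exp (-t) else 1) := by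
          refine Finset.sum_congr rfl fun x _ => ?_
          rw [herr_def, Finset.mul_sum, Real.exp_sum]
          refine Finset.prod_congr rfl fun i _ => ?_
          cases dec (msg x) i x <;> cases x i <;> simp
      -- Summing over all messages frees `M` from `x`, so that `errorPattern_injective` applies.
      _ ≤ ∑ x, ∑ M, ∏ i, (if xor (dec M i x) (x i) then Real.exp (-t) else 1) := by
          refine Finset.sum_le_sum fun x _ => ?_
          refine Finset.single_le_sum
            (f := fun M => ∏ i, (if xor (dec M i x) (x i) then Real.exp (-t) else 1))
            (fun M _ => Finset.prod_nonneg fun i _ => ?_) (Finset.mem_univ (msg x))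
          split_ifs <;> positivity
      _ = ∑ M : Fin s → Bool, ∑ x, ∏ i, (if xor (dec M i x) (x i) then Real.exp (-t) else 1) :=
          Finset.sum_comm
      _ = ∑ M : Fin s → Bool, (Real.exp (-t) + 1) ^ m := by
          refine Finset.sum_congr rfl fun M _ => ?_
          rw [← sum_prod_weight]
          exact Function.Bijective.sum_comp
            (Finite.injective_iff_bijective.1 (errorPattern_injective (dec M) (hdec M)))
            (fun E => ∏ i, (if E i then Real.exp (-t) else 1))
      _ = 2 ^ s * (Real.exp (-t) + 1) ^ m := by simp
  have hlower : 2 ^ m * Real.exp (-t * (m * δ)) ≤ ∑ x, Real.exp (-t * err x) := by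
    -- Jensen's inequality, via the tangent to `exp` at `-t * (m * δ)`.
    calc (2 : ℝ) ^ m * Real.exp (-t * (m * δ))
        ≤ Real.exp (-t * (m * δ)) * (2 ^ m + t * (2 ^ m * (m * δ) - ∑ x, err x)) := by
          rw [mul_comm]
          refine mul_le_mul_of_nonneg_left ?_ (Real.exp_pos _).le
          have := mul_nonneg ht0.le (sub_nonneg.2 herr)
          linarith
      _ = ∑ x, Real.exp (-t * (m * δ)) * (-t * (err x - m * δ) + 1) := by
          rw [← Finset.mul_sum, Finset.sum_add_distrib, ← Finset.mul_sum, Finset.sum_sub_distrib]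
          simp
          ring
      _ ≤ ∑ x, Real.exp (-t * err x) := by
          refine Finset.sum_le_sum fun x _ => ?_
          calc _ ≤ Real.exp (-t * (m * δ)) * Real.exp (-t * (err x - m * δ)) :=
                mul_le_mul_of_nonneg_left (Real.add_one_le_exp _) (Real.exp_pos _).le
            _ = _ := by rw [← Real.exp_add]; ring_nf
  have hbase : Real.exp (-t) + 1 ≤ 2 * Real.exp (-t / 2 + t ^ 2 / 8) := by
    have h := Real.cosh_le_exp_half_sq (t / 2)
    rw [Real.cosh_eq] at h
    have h1 : Real.exp (-t) + 1 =
        2 * (Real.exp (-t / 2) * ((Real.exp (t / 2) + Real.exp (-(t / 2))) / 2)) := by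
      have e1 : Real.exp (-t / 2) * Real.exp (t / 2) = 1 := by
        rw [← Real.exp_add]; ring_nf; exact Real.exp_zero
      have e2 : Real.exp (-t / 2) * Real.exp (-(t / 2)) = Real.exp (-t) := by
        rw [← Real.exp_add]; ring_nf
      linear_combination -e1 - e2
    rw [h1, Real.exp_add]
    have : t ^ 2 / 8 = (t / 2) ^ 2 / 2 := by ring
    rw [this]
    gcongr
  have hs : (2 : ℝ) ^ s ≤ Real.exp s := by
    rw [← Real.exp_one_pow]
    exact pow_le_pow_left₀ (by norm_num) (by linarith [Real.add_one_le_exp (1 : ℝ)]) s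
  have hmain : (2 : ℝ) ^ m * Real.exp (-t * (m * δ)) ≤
      2 ^ m * Real.exp (s + m * (-t / 2 + t ^ 2 / 8)) := by
    calc (2 : ℝ) ^ m * Real.exp (-t * (m * δ)) ≤ 2 ^ s * (Real.exp (-t) + 1) ^ m :=
          hlower.trans hupper
      _ ≤ Real.exp s * (2 * Real.exp (-t / 2 + t ^ 2 / 8)) ^ m := by
          gcongr
      _ = _ := by rw [mul_pow, ← Real.exp_nat_mul, Real.exp_add]; ring
  have hexp := Real.exp_le_exp.1 (le_of_mul_le_mul_left hmain (by positivity))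
  rw [ht] at hexp
  linarith

/-- Augmented indexing: if a message of `s` bits about `x` allows to recover each `x i` with error
probability `δ < 1 / 2` by a receiver who knows the coordinates of `x` above `i`, then `s` is
linear in the length of `x`. -/
theorem augmentedIndex {Ω : Type*} [MeasurableSpace Ω] (μ : Measure Ω) [IsProbabilityMeasure μ]
    {m s : ℕ} {δ : ℝ} (hδ₀ : 0 ≤ δ) (hδ : δ < 1 / 2)
    (msg : Ω → (Fin m → Bool) → (Fin s → Bool))
    (dec : Ω → (Fin s → Bool) → Fin m → (Fin m → Bool) → Bool)
    (hdec : ∀ ω M i x y, (∀ j, i < j → x j = y j) → dec ω M i x = dec ω M i y)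
    (herr : ∀ x i, μ {ω | dec ω (msg ω x) i x ≠ x i} ≤ ENNReal.ofReal δ) :
    2 * (1 / 2 - δ) ^ 2 * m ≤ s := by
  -- The error events need not be measurable; measurable hulls have the same measure.
  set T : (Fin m → Bool) → Fin m → Set Ω :=
    fun x i => toMeasurable μ {ω | dec ω (msg ω x) i x ≠ x i} with hT
  have hTm : ∀ x i, MeasurableSet (T x i) := fun x i => measurableSet_toMeasurable _ _
  have hint : ∫⁻ ω, ∑ x, ∑ i, (T x i).indicator 1 ω ∂μ ≤ ENNReal.ofReal (2 ^ m * (m * δ)) := by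
    rw [lintegral_finsetSum _ fun x _ => Finset.measurable_sum _ fun i _ =>
      measurable_one.indicator (hTm x i)]
    calc ∑ x, ∫⁻ ω, ∑ i, (T x i).indicator 1 ω ∂μ
        ≤ ∑ x : Fin m → Bool, ∑ i : Fin m, ENNReal.ofReal δ := by
          refine Finset.sum_le_sum fun x _ => ?_
          rw [lintegral_finsetSum _ fun i _ => measurable_one.indicator (hTm x i)]
          refine Finset.sum_le_sum fun i _ => ?_
          rw [lintegral_indicator_one (hTm x i), hT, measure_toMeasurable]
          exact herr x i
      _ = ENNReal.ofReal (2 ^ m * (m * δ)) := by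
          rw [ENNReal.ofReal_mul (by positivity), ENNReal.ofReal_mul (by positivity),
            ENNReal.ofReal_pow (by norm_num)]
          simp
  -- Some fixed outcome of the coins errs at most as often as the average.
  obtain ⟨ω, hω⟩ := exists_le_lintegral (μ := μ)
    (f := fun ω => ∑ x, ∑ i, (T x i).indicator (1 : Ω → ENNReal) ω)
    (Finset.measurable_sum _ fun x _ => Finset.measurable_sum _ fun i _ =>
      measurable_one.indicator (hTm x i)).aemeasurable
  refine augmentedIndex_deterministic hδ (msg ω) (dec ω) (hdec ω) ?_
  rw [← ENNReal.ofReal_le_ofReal_iff (by positivity)]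
  refine le_trans ?_ (hω.trans hint)
  rw [ENNReal.ofReal_sum_of_nonneg fun x _ => Finset.sum_nonneg fun i _ => by
    split_ifs <;> norm_num]
  refine Finset.sum_le_sum fun x _ => ?_
  rw [ENNReal.ofReal_sum_of_nonneg fun i _ => by split_ifs <;> norm_num]
  refine Finset.sum_le_sum fun i _ => ?_
  split_ifs with h
  · rw [Set.indicator_of_mem (subset_toMeasurable μ _ h)]
    simp
  · simp

/-! ### The reduction to streaming -/

/-- The data set with the given labelled points. -/
def Instance.ofPoints {n d : ℕ} (p : Fin n → (Fin d → ℝ) × ℤˣ) : Instance n d where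
  Z := fun i => (p i).1
  Y := fun i => (p i).2

theorem StreamingAlgorithm.runFrom_append {Ω : Type*} {d s : ℕ} (A : StreamingAlgorithm Ω d s)
    (ω : Ω) (t : ℕ) (M : Fin s → Bool) (p q : List ((Fin d → ℝ) × ℤˣ)) :
    A.runFrom ω t M (p ++ q) = A.runFrom ω (t + p.length) (A.runFrom ω t M p) q := by
  induction p generalizing t M with
  | nil => rfl
  | cons a p ih =>
    simp only [List.cons_append, StreamingAlgorithm.runFrom, List.length_cons]
    rw [ih, Nat.add_right_comm, Nat.add_assoc]

theorem StreamingAlgorithm.result_append {Ω : Type*} {d s k l : ℕ}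
    (A : StreamingAlgorithm Ω d s) (ω : Ω) (p : Fin k → (Fin d → ℝ) × ℤˣ)
    (q : Fin l → (Fin d → ℝ) × ℤˣ) :
    A.result ω (Instance.ofPoints (Fin.append p q)) =
      A.output ω (A.runFrom ω k (A.runFrom ω 0 (A.init ω) (List.ofFn p)) (List.ofFn q)) := by
  have h : (Instance.ofPoints (Fin.append p q)).stream = List.ofFn p ++ List.ofFn q := by
    rw [← List.ofFn_fin_append]
    rfl
  rw [StreamingAlgorithm.result, h, StreamingAlgorithm.runFrom_append]
  simp

theorem ApproxWithin.eq_zero_iff {α v x : ℝ} (hα : 1 ≤ α) (h : ApproxWithin α v x)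
    (hx : 0 ≤ x) : v = 0 ↔ x = 0 := by
  obtain ⟨h1, h2⟩ := h
  constructor
  · rintro rfl
    have : x ≤ 0 := by
      rw [div_le_iff₀ (by linarith)] at h1
      simpa using h1
    linarith
  · rintro rfl
    simp only [zero_div, mul_zero] at h1 h2
    exact le_antisymm h2 h1

/-- If data sets whose first part depends on `x` and whose second part depends on `i` and on the
coordinates of `x` above `i` have target value `0` exactly when `x i` is true, then approximating
the target takes linear space. -/
theorem Approximates.space_lower_bound {Ω : Type*} [MeasurableSpace Ω] {μ : Measure Ω}
    [IsProbabilityMeasure μ] {d s k l m : ℕ} {A : StreamingAlgorithm Ω d s}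
    {P : Instance (k + l) d → Prop} {target : Instance (k + l) d → ℝ} {α δ : ℝ}
    (hA : Approximates μ A (k + l) P target α δ) (hα : 1 ≤ α) (hδ₀ : 0 ≤ δ) (hδ : δ < 1 / 2)
    (alice : (Fin m → Bool) → Fin k → (Fin d → ℝ) × ℤˣ)
    (bob : Fin m → (Fin m → Bool) → Fin l → (Fin d → ℝ) × ℤˣ)
    (hbob : ∀ i x y, (∀ j, i < j → x j = y j) → bob i x = bob i y)
    (hP : ∀ x i, P (Instance.ofPoints (Fin.append (alice x) (bob i x))))
    (hzero : ∀ x i, x i = true →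
      target (Instance.ofPoints (Fin.append (alice x) (bob i x))) = 0)
    (hpos : ∀ x i, x i = false →
      0 < target (Instance.ofPoints (Fin.append (alice x) (bob i x)))) :
    2 * (1 / 2 - δ) ^ 2 * m ≤ s := by
  classical
  refine augmentedIndex μ hδ₀ hδ
    (fun ω x => A.runFrom ω 0 (A.init ω) (List.ofFn (alice x)))
    (fun ω M i x => decide (A.output ω (A.runFrom ω k M (List.ofFn (bob i x))) = 0)) ?_ ?_
  · intro ω M i x y h
    simp only [hbob i x y h]
  · intro x i
    refine (measure_mono ?_).trans (hA _ (hP x i))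
    intro ω hω happ
    refine hω ?_
    rw [← StreamingAlgorithm.result_append]
    cases hxi : x i with
    | true =>
      have h0 := hzero x i hxi
      simpa using (happ.eq_zero_iff hα h0.ge).2 h0
    | false =>
      have h0 := hpos x i hxi
      simpa using fun h => h0.ne' ((happ.eq_zero_iff hα h0.le).1 h)

/-! ### Optimal costs that vanish and optimal costs that do not -/

theorem log_one_add_exp_nonneg (z : ℝ) : 0 ≤ Real.log (1 + Real.exp z) :=
  Real.log_nonneg (by linarith [Real.exp_pos z])

theorem bddBelow_logisticLoss {ι : Type*} {n : ℕ} (margin : ι → Fin n → ℝ) :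
    BddBelow (Set.range fun q => ∑ i, Real.log (1 + Real.exp (-margin q i))) :=
  ⟨0, by rintro _ ⟨q, rfl⟩; exact Finset.sum_nonneg fun i _ => log_one_add_exp_nonneg _⟩

theorem iInf_logisticLoss_eq_zero {ι : Type*} {n : ℕ} (margin : ι → Fin n → ℝ)
    (h : ∀ K : ℝ, ∃ q, ∀ i, K ≤ margin q i) :
    ⨅ q, ∑ i, Real.log (1 + Real.exp (-margin q i)) = 0 := by
  refine le_antisymm ?_ (Real.iInf_nonneg fun q =>
    Finset.sum_nonneg fun i _ => log_one_add_exp_nonneg _)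
  have hK : ∀ K : ℝ, ⨅ q, ∑ i, Real.log (1 + Real.exp (-margin q i)) ≤ n * Real.exp (-K) := by
    intro K
    obtain ⟨q, hq⟩ := h K
    refine (ciInf_le (bddBelow_logisticLoss margin) q).trans ?_
    calc ∑ i, Real.log (1 + Real.exp (-margin q i)) ≤ ∑ _i : Fin n, Real.exp (-K) := by
          refine Finset.sum_le_sum fun i _ => ?_
          have h1 := Real.log_le_sub_one_of_pos
            (show 0 < 1 + Real.exp (-margin q i) by positivity)
          have h2 := Real.exp_le_exp.2 (neg_le_neg (hq i))
          linarith
      _ = n * Real.exp (-K) := by simp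
  have hlim : Filter.Tendsto (fun K : ℝ => n * Real.exp (-K)) Filter.atTop (nhds 0) := by
    simpa using (Real.tendsto_exp_neg_atTop_nhds_zero).const_mul (n : ℝ)
  exact ge_of_tendsto' hlim hK

/-- A single point with nonpositive margin already costs `log 2`. -/
theorem iInf_logisticLoss_pos {ι : Type*} [Nonempty ι] {n : ℕ} (margin : ι → Fin n → ℝ)
    (h : ∀ q, ∃ i, margin q i ≤ 0) :
    0 < ⨅ q, ∑ i, Real.log (1 + Real.exp (-margin q i)) := by
  refine (Real.log_pos one_lt_two).trans_le (le_ciInf fun q => ?_)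
  obtain ⟨i, hi⟩ := h q
  refine le_trans ?_ (Finset.single_le_sum
    (f := fun i => Real.log (1 + Real.exp (-margin q i)))
    (fun i _ => log_one_add_exp_nonneg _) (Finset.mem_univ i))
  refine Real.log_le_log two_pos ?_
  have := Real.one_le_exp (neg_nonneg.2 hi)
  linarith

theorem Instance.opt_eq_zero {n d : ℕ} (I : Instance n d) (β : Fin d → ℝ)
    (h : ∀ i, 1 ≤ ((I.Y i : ℤ) : ℝ) * (I.Z i ⬝ᵥ β)) : I.opt = 0 := by
  refine iInf_logisticLoss_eq_zero (fun β i => ((I.Y i : ℤ) : ℝ) * (I.Z i ⬝ᵥ β)) fun K =>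
    ⟨|K| • β, fun i => ?_⟩
  simp only [dotProduct_smul, smul_eq_mul]
  nlinarith [h i, abs_nonneg K, le_abs_self K]

theorem Instance.opt_pos {n d : ℕ} (I : Instance n d)
    (h : ∀ β : Fin d → ℝ, ∃ i, ((I.Y i : ℤ) : ℝ) * (I.Z i ⬝ᵥ β) ≤ 0) : 0 < I.opt :=
  iInf_logisticLoss_pos (fun β i => ((I.Y i : ℤ) : ℝ) * (I.Z i ⬝ᵥ β)) h

theorem Instance.affineOpt_eq_zero {n d : ℕ} (I : Instance n d) (β : Fin d → ℝ) (b : ℝ)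
    (h : ∀ i, 1 ≤ ((I.Y i : ℤ) : ℝ) * (I.Z i ⬝ᵥ β + b)) : I.affineOpt = 0 := by
  refine iInf_logisticLoss_eq_zero
    (fun (p : (Fin d → ℝ) × ℝ) i => ((I.Y i : ℤ) : ℝ) * (I.Z i ⬝ᵥ p.1 + p.2)) fun K =>
    ⟨(|K| • β, |K| * b), fun i => ?_⟩
  simp only [dotProduct_smul, smul_eq_mul]
  nlinarith [h i, abs_nonneg K, le_abs_self K]

theorem Instance.affineOpt_pos {n d : ℕ} (I : Instance n d)
    (h : ∀ (β : Fin d → ℝ) (b : ℝ), ∃ i, ((I.Y i : ℤ) : ℝ) * (I.Z i ⬝ᵥ β + b) ≤ 0) :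
    0 < I.affineOpt :=
  iInf_logisticLoss_pos
    (fun (p : (Fin d → ℝ) × ℝ) i => ((I.Y i : ℤ) : ℝ) * (I.Z i ⬝ᵥ p.1 + p.2))
    fun p => h p.1 p.2

/-! ### Hard data sets without intercept: comparing integers -/

/-- The number with binary digits `x`. -/
def binaryValue {m : ℕ} (x : Fin m → Bool) : ℕ :=
  ∑ j, if x j then 2 ^ (j : ℕ) else 0

/-- The largest number with the binary digits of `x` above `i` and the `i`-th digit `0`. -/
def threshold {m : ℕ} (i : Fin m) (x : Fin m → Bool) : ℕ :=
  ∑ j, if j < i ∨ i < j ∧ x j = true then 2 ^ (j : ℕ) else 0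

theorem sum_two_pow_lt (m : ℕ) : ∑ j : Fin m, 2 ^ (j : ℕ) < 2 ^ m := by
  rw [Fin.sum_univ_eq_sum_range (fun j => 2 ^ j) m, Nat.geomSum_eq le_rfl]
  have := Nat.two_pow_pos m
  omega

theorem binaryValue_lt {m : ℕ} (x : Fin m → Bool) : binaryValue x < 2 ^ m :=
  (Finset.sum_le_sum fun j _ => by split_ifs <;> simp).trans_lt (sum_two_pow_lt m)

theorem threshold_lt {m : ℕ} (i : Fin m) (x : Fin m → Bool) : threshold i x < 2 ^ m :=
  (Finset.sum_le_sum fun j _ => by split_ifs <;> simp).trans_lt (sum_two_pow_lt m)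

theorem threshold_congr {m : ℕ} (i : Fin m) (x y : Fin m → Bool)
    (h : ∀ j, i < j → x j = y j) : threshold i x = threshold i y := by
  refine Finset.sum_congr rfl fun j _ => ?_
  by_cases hj : i < j
  · rw [h j hj]
  · simp [hj]

theorem sum_two_pow_below_lt {m : ℕ} (i : Fin m) :
    ∑ j : Fin m, (if j < i then 2 ^ (j : ℕ) else 0) < 2 ^ (i : ℕ) := by
  have h : ∑ j : Fin m, (if j < i then 2 ^ (j : ℕ) else 0) = ∑ j ∈ Finset.range i, 2 ^ j := by
    simp only [Fin.lt_def]
    rw [Fin.sum_univ_eq_sum_range (fun j => if j < (i : ℕ) then 2 ^ j else 0) m,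
      ← Finset.sum_filter]
    congr 1
    ext j
    have := i.2
    simp only [Finset.mem_filter, Finset.mem_range]
    omega
  rw [h, ← Fin.sum_univ_eq_sum_range (fun j => 2 ^ j)]
  exact sum_two_pow_lt _

/-- Digit `i` alone outweighs all lower digits together. -/
theorem threshold_lt_binaryValue {m : ℕ} {i : Fin m} {x : Fin m → Bool} (hx : x i = true) :
    threshold i x < binaryValue x := by
  calc threshold i x
      = ∑ j : Fin m, (if j < i then 2 ^ (j : ℕ) else 0) +
          ∑ j : Fin m, (if i < j ∧ x j = true then 2 ^ (j : ℕ) else 0) := by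
        rw [threshold, ← Finset.sum_add_distrib]
        refine Finset.sum_congr rfl fun j _ => ?_
        grind
    _ < 2 ^ (i : ℕ) + ∑ j : Fin m, (if i < j ∧ x j = true then 2 ^ (j : ℕ) else 0) :=
        Nat.add_lt_add_right (sum_two_pow_below_lt i) _
    _ = ∑ j : Fin m, ((if j = i then 2 ^ (j : ℕ) else 0) +
          (if i < j ∧ x j = true then 2 ^ (j : ℕ) else 0)) := by
        rw [Finset.sum_add_distrib]
        simp
    _ ≤ binaryValue x := by
        refine Finset.sum_le_sum fun j _ => ?_
        grind

theorem binaryValue_le_threshold {m : ℕ} {i : Fin m} {x : Fin m → Bool} (hx : x i = false) :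
    binaryValue x ≤ threshold i x := by
  refine Finset.sum_le_sum fun j _ => ?_
  rcases lt_trichotomy j i with h | rfl | h
  · split_ifs <;> simp_all
  · simp [hx]
  · simp [h, h.not_gt]

/-- A linear lower bound for the model without intercept. -/
theorem Approximates.opt_space {Ω : Type*} [MeasurableSpace Ω] {μ : Measure Ω}
    [IsProbabilityMeasure μ] {s n : ℕ} (hn : 3 ≤ n) {A : StreamingAlgorithm Ω 2 s} {α δ : ℝ}
    (hα : 1 ≤ α) (hδ₀ : 0 ≤ δ) (hδ : δ < 1 / 2)
    (hA : Approximates μ A n (fun I => I.OnGrid (2 ^ n)) (fun I => I.opt) α δ) :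
    2 * (1 / 2 - δ) ^ 2 * n ≤ s := by
  obtain ⟨k, rfl⟩ : ∃ k, n = 1 + (k + 2) := ⟨n - 3, by omega⟩
  -- The points `(1, 0)` force `β 0 > 0`; one would do, the others pad the stream to length `n`.
  refine hA.space_lower_bound (m := 1 + (k + 2)) hα hδ₀ hδ
    (fun x _ => (![(binaryValue x : ℝ), 1], 1))
    (fun i x => Fin.cons (![(threshold i x : ℝ), 1], -1) fun _ => (![1, 0], 1)) ?_ ?_ ?_ ?_
  · intro i x y h
    rw [threshold_congr i x y h]
  · intro x i a
    refine Fin.addCases (fun a j => ?_) (fun a => ?_) a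
    · simp only [Instance.ofPoints, Fin.append_left]
      fin_cases j
      · exact ⟨binaryValue x, by simp, by
          rw [Nat.abs_cast]; exact_mod_cast (binaryValue_lt x).le⟩
      · exact ⟨1, by simp, by simpa using one_le_pow₀ one_le_two⟩
    · simp only [Instance.ofPoints, Fin.append_right]
      refine Fin.cases (fun j => ?_) (fun a j => ?_) a
      · fin_cases j
        · exact ⟨threshold i x, by simp, by
            rw [Nat.abs_cast]; exact_mod_cast (threshold_lt i x).le⟩
        · exact ⟨1, by simp, by simpa using one_le_pow₀ one_le_two⟩
      · fin_cases j
        · exact ⟨1, by simp, by simpa using one_le_pow₀ one_le_two⟩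
        · exact ⟨0, by simp, by simp⟩
  · intro x i hx
    have hlt : (threshold i x : ℝ) + 1 ≤ binaryValue x := by
      exact_mod_cast threshold_lt_binaryValue hx
    -- The boundary passes midway between the two integers, so both margins equal their difference.
    refine Instance.opt_eq_zero _ ![2, -(threshold i x + binaryValue x)] fun a => ?_
    refine Fin.addCases (fun a => ?_) (fun a => ?_) a
    · simp [Instance.ofPoints, dotProduct, Fin.sum_univ_two]
      linarith
    · simp only [Instance.ofPoints, Fin.append_right]
      refine Fin.cases ?_ (fun a => ?_) a
      · simp [dotProduct, Fin.sum_univ_two]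
        linarith
      · simp [dotProduct, Fin.sum_univ_two]
  · intro x i hx
    have hle : (binaryValue x : ℝ) ≤ threshold i x := by
      exact_mod_cast binaryValue_le_threshold hx
    refine Instance.opt_pos _ fun β => ?_
    by_contra! h
    have h1 := h (Fin.castAdd (k + 2) 0)
    have h2 := h (Fin.natAdd 1 (0 : Fin (k + 2)))
    have h3 := h (Fin.natAdd 1 (Fin.succ (0 : Fin (k + 1))))
    simp only [Instance.ofPoints, Fin.append_left, Fin.append_right, Fin.cons_zero,
      Fin.cons_succ] at h1 h2 h3
    simp [dotProduct, Fin.sum_univ_two] at h1 h2 h3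
    nlinarith

/-! ### Hard data sets with intercept: points on a parabola -/

/-- A linear lower bound for the model with intercept. -/
theorem Approximates.affineOpt_space {Ω : Type*} [MeasurableSpace Ω] {μ : Measure Ω}
    [IsProbabilityMeasure μ] {s m : ℕ} {A : StreamingAlgorithm Ω 2 s} {α δ : ℝ}
    (hα : 1 ≤ α) (hδ₀ : 0 ≤ δ) (hδ : δ < 1 / 2)
    (hA : Approximates μ A (m + 1) (fun I => I.OnGrid ((m + 1) ^ 2)) (fun I => I.affineOpt) α δ) :
    2 * (1 / 2 - δ) ^ 2 * m ≤ s := by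
  -- The value `m` is a dummy: no query `i : Fin m` hits it.
  set node : (Fin m → Bool) → Fin m → ℕ := fun x j => if x j then m else j with hnode
  have hnode_le : ∀ x j, node x j ≤ m := by
    intro x j
    simp only [hnode]
    split_ifs
    · exact le_rfl
    · exact j.2.le
  have hgrid : ∀ (a : ℕ), a ≤ m → ∀ j : Fin 2,
      ∃ z : ℤ, ![(a : ℝ), (a : ℝ) ^ 2] j = z ∧ |z| ≤ (((m + 1) ^ 2 : ℕ) : ℤ) := by
    intro a ha j
    fin_cases j
    · exact ⟨a, by simp, by rw [Nat.abs_cast]; exact_mod_cast by nlinarith⟩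
    · exact ⟨(a ^ 2 : ℕ), by simp, by
        rw [Nat.abs_cast]; exact_mod_cast Nat.pow_le_pow_left (by omega) 2⟩
  refine hA.space_lower_bound (m := m) hα hδ₀ hδ
    (fun x j => (![(node x j : ℝ), (node x j : ℝ) ^ 2], 1))
    (fun i _ _ => (![((i : ℕ) : ℝ), ((i : ℕ) : ℝ) ^ 2], -1)) ?_ ?_ ?_ ?_
  · intro i x y _
    rfl
  · intro x i a
    refine Fin.addCases (fun a => ?_) (fun a => ?_) a
    · simp only [Instance.ofPoints, Fin.append_left]
      exact hgrid _ (hnode_le x a)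
    · simp only [Instance.ofPoints, Fin.append_right]
      exact hgrid _ i.2.le
  · intro x i hx
    -- On the parabola at abscissa `t` this affine function is `2 * (t - i) ^ 2 - 1`: it is `-1` at
    -- the query and at least `1` at any other integer.
    refine Instance.affineOpt_eq_zero _ ![-4 * ((i : ℕ) : ℝ), 2] (2 * ((i : ℕ) : ℝ) ^ 2 - 1)
      fun a => ?_
    refine Fin.addCases (fun a => ?_) (fun a => ?_) a
    · simp only [Instance.ofPoints, Fin.append_left]
      have hne : ((node x a : ℕ) : ℤ) - (i : ℕ) ≠ 0 := by
        have hi := i.2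
        by_cases ha : x a = true
        · simp only [hnode, ha, if_true]
          omega
        · have : (a : ℕ) ≠ i := fun h => ha (Fin.ext h ▸ hx)
          simp only [hnode, ha]
          simp
          omega
      have hsq : (1 : ℝ) ≤ ((node x a : ℝ) - (i : ℕ)) ^ 2 := by
        have h1 : (1 : ℤ) ≤ (((node x a : ℕ) : ℤ) - (i : ℕ)) ^ 2 := by
          have := sq_pos_of_ne_zero hne
          omega
        exact_mod_cast h1
      simp [dotProduct, Fin.sum_univ_two]
      nlinarith
    · simp only [Instance.ofPoints, Fin.append_right]
      simp [dotProduct, Fin.sum_univ_two]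
      nlinarith
  · intro x i hx
    refine Instance.affineOpt_pos _ fun β b => ?_
    by_contra! h
    -- Here `node x i = i`: the same point carries both labels.
    have h1 := h (Fin.castAdd 1 i)
    have h2 := h (Fin.natAdd m 0)
    simp only [Instance.ofPoints, Fin.append_left, Fin.append_right] at h1 h2
    simp [hnode, hx] at h1 h2
    linarith

end LogisticStreaming

theorem theorem2 (δ : ℝ) (hδ : 0 ≤ δ) (hδ' : δ < 1 / 2) :
    ∃ c : ℝ, 0 < c ∧ ∃ n₀ : ℕ, ∀ n : ℕ, n₀ ≤ n → ∀ α : ℝ, 1 ≤ α →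
      ∀ (Ω : Type*) [MeasurableSpace Ω] (μ : MeasureTheory.Measure Ω)
        [MeasureTheory.IsProbabilityMeasure μ]
        (s : ℕ) (A : LogisticStreaming.StreamingAlgorithm Ω 2 s),
        (LogisticStreaming.Approximates μ A n (fun I => I.OnGrid (2 ^ n))
            (fun I => I.opt) α δ →
          c * (n / Real.log n) ≤ s) ∧
        (LogisticStreaming.Approximates μ A n (fun I => I.OnGrid (n ^ 2))
            (fun I => I.affineOpt) α δ →
          c * n ≤ s) := by
  have hc : 0 < (1 / 2 - δ) ^ 2 := by
    have : 0 < 1 / 2 - δ := by linarith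
    positivity
  -- Dropping the factor `2` absorbs the loss from `n` to `n - 1` points; `n ≥ 3` gives `log n ≥ 1`.
  refine ⟨(1 / 2 - δ) ^ 2, hc, 3, fun n hn α hα Ω _ μ _ s A => ⟨fun hA => ?_, fun hA => ?_⟩⟩
  · have h := hA.opt_space hn hα hδ hδ'
    have hn' : (3 : ℝ) ≤ n := by exact_mod_cast hn
    have hlog : 1 ≤ Real.log n := by
      rw [Real.le_log_iff_exp_le (by linarith)]
      linarith [Real.exp_one_lt_d9]
    have hdiv : (n : ℝ) / Real.log n ≤ n := div_le_self (by linarith) hlog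
    nlinarith
  · obtain ⟨m, rfl⟩ : ∃ m, n = m + 1 := ⟨n - 1, by omega⟩
    have h := hA.affineOpt_space hα hδ hδ'
    have hm : (2 : ℝ) ≤ m := by exact_mod_cast (by omega : 2 ≤ m)
    push_cast
    nlinarith
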